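/- Let $P$ be a finite poset. The rank $r(x)$ of $x\in P$ is defined recursively by $r(x)=0$ if $x$ is minimal and $r(x)=\max\{r(y):y<x\}+1$ otherwise; the layer $P_k$ is the set of elements of rank $k$. The poset $P$ is called LYM if every antichain $A\subseteq P$ satisfies $\sum_{x\in A}\frac{1}{|P_{r(x)}|}\le 1$, and log-concave if the fractions $\frac{|P_{k+1}|}{|P_k|}$, over those $k\ge 0$ with $P_k\neq\emptyset$, are (weakly) decreasing in $k$. **Theorem (Harper, 1974).** Let $P$ and $Q$ be finite posets that are both log-concave and LYM. Then the product poset $P\times Q$, with $(x_P,x_Q)\le(y_P,y_Q)$ if and only if $x_P\le y_P$ and $x_Q\le y_Q$, is also LYM and log-concave. -/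

import Mathlib

namespace RankedPoset

/-- The rank of `x`: the length `n` of a longest chain `x₀ < x₁ < ⋯ < xₙ = x` ending at `x`.
On a finite poset, `rank_eq_zero` and `isGreatest_rank` below show that this is the function with
`rank x = 0` for `x` minimal and `rank x = max {rank y | y < x} + 1` otherwise. -/
noncomputable def rank {P : Type*} [PartialOrder P] (x : P) : ℕ :=
  (Order.height x).toNat

/-- The layer `P_k`: all elements of rank `k`. -/
def layer (P : Type*) [PartialOrder P] (k : ℕ) : Set P :=
  {x | rank x = k}

/-- A poset `P` is LYM if `∑_{x ∈ A} 1 / |P_{r(x)}| ≤ 1` for every antichain `A`. -/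
def IsLYM (P : Type*) [PartialOrder P] : Prop :=
  ∀ A : Finset P, IsAntichain (· ≤ ·) (A : Set P) →
    ∑ x ∈ A, (1 : ℚ) / ((layer P (rank x)).ncard : ℚ) ≤ 1

/-- A poset `P` is log-concave if the fractions `|P_{k+1}| / |P_k|`, over those `k` for which
the denominator is nonzero, are (weakly) decreasing in `k`. -/
def IsLogConcave (P : Type*) [PartialOrder P] : Prop :=
  AntitoneOn (fun k : ℕ => ((layer P (k + 1)).ncard : ℚ) / ((layer P k).ncard : ℚ))
    {k : ℕ | (layer P k).ncard ≠ 0}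

theorem height_eq_rank {P : Type*} [PartialOrder P] [Finite P] (x : P) :
    Order.height x = (rank x : ℕ∞) := by
  have := Fintype.ofFinite P
  have h : Order.height x ≤ (Fintype.card P : ℕ∞) :=
    Order.height_le fun p _ => by exact_mod_cast p.length_lt_card.le
  exact (ENat.natCast_toNat (ne_top_of_le_ne_top (ENat.natCast_ne_top _) h)).symm

theorem rank_eq_zero {P : Type*} [PartialOrder P] {x : P} (h : ∀ y, ¬ y < x) :
    rank x = 0 := by
  have : Order.height x = 0 := Order.height_eq_zero.2 (isMin_iff_forall_not_lt.2 h)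
  simp [rank, this]

theorem isGreatest_rank {P : Type*} [PartialOrder P] [Finite P] {x : P} (h : ∃ y, y < x) :
    IsGreatest {n : ℕ | ∃ y, y < x ∧ n = rank y + 1} (rank x) := by
  have up : ∀ y, y < x → rank y + 1 ≤ rank x := by
    intro y hy
    have := Order.height_add_one_le hy
    rw [height_eq_rank, height_eq_rank] at this
    exact_mod_cast this
  refine ⟨?_, ?_⟩
  · by_contra hne
    have hlt : ∀ y, y < x → rank y + 1 < rank x := fun y hy =>
      lt_of_le_of_ne (up y hy) fun e => hne ⟨y, hy, e.symm⟩
    have hle : Order.height x ≤ ((rank x - 1 : ℕ) : ℕ∞) := by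
      rw [Order.height_le_coe_iff]
      intro y hy
      rw [height_eq_rank]
      have := hlt y hy
      exact_mod_cast (by omega : rank y < rank x - 1)
    rw [height_eq_rank] at hle
    obtain ⟨y, hy⟩ := h
    have h1 := hlt y hy
    have h2 : rank x ≤ rank x - 1 := by exact_mod_cast hle
    omega
  · rintro n ⟨y, hy, rfl⟩
    exact up y hy

end RankedPoset

/-! Write p, q, W for the layer sizes of P, Q and P × Q. Ranks add (`rank_prod`), so W is the
convolution of p and q, and a Cauchy–Binet identity expresses its log-concavity through products of
minors of p and q that have the same sign.

For LYM, the antichain inequality extends to nonnegative functions bounded on chains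
(`sum_mul_le_of_chain_sum_le`). Used once in Q and once in P, this reduces an antichain A to A ∩ (C
× D) with C, D chains and weights p_i q_j / W_(i+j). Such a weight is the share of rank pairs (i, j)
in their layer; ordering the layer by first rank makes it a subinterval of [0, 1]. Along A ∩ (C × D)
the first rank rises while the second falls, and log-concavity keeps these intervals from
overlapping (`lowerFraction_le_of_cross`), so their lengths total at most 1. -/

open Finset

namespace RankedPoset

/-! ### Log-concave sequences, convolutions and level proportions. -/

section LevelCount

/-- The number of elements at integer level `k` of a function `r` on a finite type. -/
def levelCount {α : Type*} [Fintype α] (r : α → ℤ) (k : ℤ) : ℚ :=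
  (#{x | r x = k} : ℚ)

/-- Log-concavity of a sequence indexed by the integers, without internal zeros. -/
def IsLogConcaveSeq (p : ℤ → ℚ) : Prop :=
  ∀ a b, a ≤ b → p (a - 1) * p (b + 1) ≤ p a * p b

variable {α β : Type*} [Fintype α] [Fintype β]

theorem levelCount_nonneg (r : α → ℤ) (k : ℤ) : 0 ≤ levelCount r k :=
  Nat.cast_nonneg _

theorem levelCount_pos (r : α → ℤ) (x : α) : 0 < levelCount r (r x) := by
  unfold levelCount
  exact_mod_cast Finset.card_pos.2 ⟨x, by simp⟩

theorem IsLogConcaveSeq.mul_le_mul_shift {p : ℤ → ℚ} (hp : IsLogConcaveSeq p) (m n : ℤ) (d : ℕ)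
    (h : m + d ≤ n - d) : p m * p n ≤ p (m + d) * p (n - d) := by
  induction d with
  | zero => simp
  | succ d ih =>
    push_cast at h ⊢
    refine (ih (by omega)).trans ?_
    have := hp (m + (d + 1)) (n - (d + 1)) h
    rwa [show m + ((d : ℤ) + 1) - 1 = m + d by ring,
      show n - ((d : ℤ) + 1) + 1 = n - d by ring] at this

/-- With the sum of indices fixed, moving both inward can only increase the product. -/
theorem IsLogConcaveSeq.mul_le_mul_of_le {p : ℤ → ℚ} (hp : IsLogConcaveSeq p) {m n x y : ℤ}
    (hx : m ≤ x) (hy : m ≤ y) (h : m + n = x + y) : p m * p n ≤ p x * p y := by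
  rcases le_total x y with hxy | hxy
  · obtain ⟨d, rfl⟩ := Int.le.dest hx
    obtain rfl : y = n - d := by omega
    exact hp.mul_le_mul_shift m n d hxy
  · obtain ⟨d, rfl⟩ := Int.le.dest hy
    obtain rfl : x = n - d := by omega
    rw [mul_comm (p (n - d))]
    exact hp.mul_le_mul_shift m n d hxy

/-- The number of pairs of total level `k` satisfying a condition on the first level, as a sum
over the first component. -/
theorem card_pairs_eq_sum (r : α → ℤ) (s : β → ℤ) (k : ℤ) (c : ℤ → Prop) [DecidablePred c] :
    (#{z : α × β | r z.1 + s z.2 = k ∧ c (r z.1)} : ℚ) =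
      ∑ x with c (r x), levelCount s (k - r x) := by
  classical
  rw [Finset.sum_filter, Finset.card_filter, Nat.cast_sum, Fintype.sum_prod_type]
  refine Finset.sum_congr rfl fun x _ => ?_
  by_cases hc : c (r x)
  · simp only [hc, and_true, if_true, levelCount, Finset.card_filter, Nat.cast_sum]
    refine Finset.sum_congr rfl fun y _ => ?_
    have : r x + s y = k ↔ s y = k - r x := by omega
    simp [this]
  · simp [hc]

theorem levelCount_add_eq_sum (r : α → ℤ) (s : β → ℤ) (k : ℤ) :
    levelCount (fun z : α × β => r z.1 + s z.2) k = ∑ x, levelCount s (k - r x) := by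
  simpa [levelCount] using card_pairs_eq_sum r s k (fun _ => True)

theorem levelCount_add_comm (r : α → ℤ) (s : β → ℤ) (k : ℤ) :
    levelCount (fun z : β × α => s z.1 + r z.2) k =
      levelCount (fun z : α × β => r z.1 + s z.2) k := by
  classical
  unfold levelCount
  norm_cast
  exact Finset.card_equiv (Equiv.prodComm β α) (by simp [add_comm])

theorem levelCount_add_eq_convolution (r : α → ℤ) (s : β → ℤ) (k : ℤ) {I : Finset ℤ}
    (hI : ∀ x, r x ∈ I) :
    levelCount (fun z : α × β => r z.1 + s z.2) k =
      ∑ a ∈ I, levelCount r a * levelCount s (k - a) := by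
  classical
  rw [levelCount_add_eq_sum, ← Finset.sum_fiberwise_of_maps_to (t := I) (g := r) (by simp [hI])]
  refine Finset.sum_congr rfl fun a _ => ?_
  rw [Finset.sum_congr rfl (g := fun _ => levelCount s (k - a))
    (by intro x hx; rw [(Finset.mem_filter.1 hx).2])]
  simp [levelCount]

/-- Each unordered pair of indices is counted twice, hence the factor 2. -/
theorem two_mul_cauchyBinet {ι : Type*} (I : Finset ι) (X Y Z T : ι → ℚ) :
    ∑ a ∈ I, ∑ b ∈ I, (X a * Y b - X b * Y a) * (Z a * T b - Z b * T a) =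
      2 * ((∑ a ∈ I, X a * Z a) * (∑ a ∈ I, Y a * T a) -
        (∑ a ∈ I, X a * T a) * (∑ a ∈ I, Y a * Z a)) := by
  have h1 : (∑ a ∈ I, X a * Z a) * (∑ a ∈ I, Y a * T a) =
      ∑ a ∈ I, ∑ b ∈ I, (X a * Z a) * (Y b * T b) := Finset.sum_mul_sum ..
  have h2 : (∑ a ∈ I, X a * T a) * (∑ a ∈ I, Y a * Z a) =
      ∑ a ∈ I, ∑ b ∈ I, (X a * T a) * (Y b * Z b) := Finset.sum_mul_sum ..
  have h1' := h1.trans Finset.sum_comm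
  have h2' := h2.trans Finset.sum_comm
  rw [two_mul]
  nth_rewrite 1 [h1, h2]
  rw [h1', h2']
  simp only [← Finset.sum_sub_distrib, ← Finset.sum_add_distrib]
  exact Finset.sum_congr rfl fun a _ => Finset.sum_congr rfl fun b _ => by ring

theorem IsLogConcaveSeq.levelCount_add {r : α → ℤ} {s : β → ℤ}
    (hr : IsLogConcaveSeq (levelCount r)) (hs : IsLogConcaveSeq (levelCount s)) :
    IsLogConcaveSeq (levelCount fun z : α × β => r z.1 + s z.2) := by
  classical
  intro k l hkl
  set I : Finset ℤ := univ.image r ∪ univ.image (fun x => r x + 1) with hI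
  have hI0 : ∀ x, r x ∈ I := fun x => by simp [hI]
  have hI1 : ∀ x, r x + 1 ∈ I := fun x => by simp [hI]
  -- Reindexing by one puts p (a - 1) in the second row, so the four Cauchy–Binet sums are W at k,
  -- l, l + 1 and k - 1.
  have shift : ∀ j, levelCount (fun z : α × β => r z.1 + s z.2) j =
      ∑ a ∈ I, levelCount r (a - 1) * levelCount s (j + 1 - a) := by
    intro j
    have h := levelCount_add_eq_convolution (fun x => r x + 1) s (j + 1) hI1
    have e : ∀ a, levelCount (fun x => r x + 1) a = levelCount r (a - 1) := by
      intro a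
      simp only [levelCount, eq_sub_iff_add_eq]
    simp only [e] at h
    rw [← h]
    unfold levelCount
    congr 2
    ext z
    simp only [Finset.mem_filter, Finset.mem_univ, true_and]
    omega
  have key := two_mul_cauchyBinet I (fun a => levelCount r a) (fun a => levelCount r (a - 1))
    (fun a => levelCount s (k - a)) (fun a => levelCount s (l + 1 - a))
  rw [← levelCount_add_eq_convolution r s k hI0, ← levelCount_add_eq_convolution r s (l + 1) hI0,
    ← shift l] at key
  have e := shift (k - 1)
  rw [sub_add_cancel] at e
  rw [← e] at key
  have pos : 0 ≤ ∑ a ∈ I, ∑ b ∈ I,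
      (levelCount r a * levelCount r (b - 1) - levelCount r b * levelCount r (a - 1)) *
      (levelCount s (k - a) * levelCount s (l + 1 - b) -
        levelCount s (k - b) * levelCount s (l + 1 - a)) := by
    have main : ∀ a b, a ≤ b →
        0 ≤ levelCount r a * levelCount r (b - 1) - levelCount r b * levelCount r (a - 1) ∧
        0 ≤ levelCount s (k - a) * levelCount s (l + 1 - b) -
          levelCount s (k - b) * levelCount s (l + 1 - a) := by
      intro a b hab
      rcases hab.eq_or_lt with rfl | hlt
      · simp
      refine ⟨sub_nonneg.2 ?_, sub_nonneg.2 ?_⟩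
      · rw [mul_comm (levelCount r b)]
        exact hr.mul_le_mul_of_le (by omega) (by omega) (by omega)
      · exact hs.mul_le_mul_of_le (by omega) (by omega) (by omega)
    refine Finset.sum_nonneg fun a _ => Finset.sum_nonneg fun b _ => ?_
    rcases le_total a b with hab | hab
    · exact mul_nonneg (main a b hab).1 (main a b hab).2
    · have := mul_nonneg (main b a hab).1 (main b a hab).2
      linarith
  rw [key] at pos
  linarith

/-- The proportion, among pairs of total level `k`, of those with first level at most `i`. -/
def lowerFraction (r : α → ℤ) (s : β → ℤ) (k i : ℤ) : ℚ :=
  (#{z : α × β | r z.1 + s z.2 = k ∧ r z.1 ≤ i} : ℚ) /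
    levelCount (fun z : α × β => r z.1 + s z.2) k

theorem levelCount_add_eq_lower_add_upper (r : α → ℤ) (s : β → ℤ) (k i : ℤ) :
    levelCount (fun z : α × β => r z.1 + s z.2) k =
      (#{z : α × β | r z.1 + s z.2 = k ∧ r z.1 ≤ i} : ℚ) +
        (#{z : α × β | r z.1 + s z.2 = k ∧ ¬ r z.1 ≤ i} : ℚ) := by
  classical
  unfold levelCount
  rw [← Finset.filter_filter, ← Finset.filter_filter]
  exact_mod_cast (Finset.card_filter_add_card_filter_not _).symm

theorem lowerFraction_nonneg (r : α → ℤ) (s : β → ℤ) (k i : ℤ) : 0 ≤ lowerFraction r s k i :=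
  div_nonneg (Nat.cast_nonneg _) (levelCount_nonneg _ _)

theorem lowerFraction_le_one (r : α → ℤ) (s : β → ℤ) (k i : ℤ) : lowerFraction r s k i ≤ 1 := by
  refine div_le_one_of_le₀ ?_ (levelCount_nonneg _ _)
  rw [levelCount_add_eq_lower_add_upper r s k i]
  exact le_add_of_nonneg_right (Nat.cast_nonneg _)

theorem lowerFraction_mono (r : α → ℤ) (s : β → ℤ) (k : ℤ) : Monotone (lowerFraction r s k) := by
  intro i j hij
  refine div_le_div_of_nonneg_right ?_ (levelCount_nonneg _ _)
  refine Nat.cast_le.2 (Finset.card_le_card fun z hz => ?_)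
  simp only [Finset.mem_filter, Finset.mem_univ, true_and] at hz ⊢
  exact ⟨hz.1, hz.2.trans hij⟩

theorem lowerFraction_sub_lowerFraction (r : α → ℤ) (s : β → ℤ) (i j : ℤ) :
    lowerFraction r s (i + j) i - lowerFraction r s (i + j) (i - 1) =
      levelCount r i * levelCount s j /
        levelCount (fun z : α × β => r z.1 + s z.2) (i + j) := by
  classical
  unfold lowerFraction
  rw [← sub_div]
  congr 1
  rw [sub_eq_iff_eq_add']
  have h : (#{z : α × β | r z.1 + s z.2 = i + j ∧ r z.1 = i} : ℚ) =
      levelCount r i * levelCount s j := by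
    rw [card_pairs_eq_sum r s (i + j) (· = i),
      Finset.sum_congr rfl (g := fun _ => levelCount s j)
        (by intro x hx; rw [(Finset.mem_filter.1 hx).2, add_sub_cancel_left])]
    simp [levelCount]
  rw [← h]
  norm_cast
  rw [← Finset.card_union_of_disjoint]
  · congr 1
    ext z
    simp only [Finset.mem_filter, Finset.mem_univ, true_and, Finset.mem_union]
    omega
  · rw [Finset.disjoint_left]
    intro z hz hz'
    simp only [Finset.mem_filter, Finset.mem_univ, true_and] at hz hz'
    omega

/-- After cross-multiplying, the lower-times-lower terms cancel. The rest compares term by term for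
r x ≤ i < r y, where k - r y is the least of the four indices. -/
theorem lowerFraction_anti {r : α → ℤ} {s : β → ℤ} (hs : IsLogConcaveSeq (levelCount s))
    {k l : ℤ} (hkl : k ≤ l) (hk : 0 < levelCount (fun z : α × β => r z.1 + s z.2) k)
    (hl : 0 < levelCount (fun z : α × β => r z.1 + s z.2) l) (i : ℤ) :
    lowerFraction r s l i ≤ lowerFraction r s k i := by
  unfold lowerFraction
  rw [div_le_div_iff₀ hl hk, levelCount_add_eq_lower_add_upper r s k i,
    levelCount_add_eq_lower_add_upper r s l i, mul_add, mul_add,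
    mul_comm (#{z : α × β | r z.1 + s z.2 = k ∧ r z.1 ≤ i} : ℚ)
      (#{z : α × β | r z.1 + s z.2 = l ∧ r z.1 ≤ i} : ℚ), add_le_add_iff_left]
  simp only [card_pairs_eq_sum r s _ (· ≤ i), card_pairs_eq_sum r s _ (fun t => ¬ t ≤ i)]
  rw [Finset.sum_mul_sum, Finset.sum_mul_sum]
  refine Finset.sum_le_sum fun x hx => Finset.sum_le_sum fun y hy => ?_
  have hx' := (Finset.mem_filter.1 hx).2
  have hy' := (Finset.mem_filter.1 hy).2
  rw [mul_comm (levelCount s (l - r x))]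
  exact hs.mul_le_mul_of_le (by omega) (by omega) (by omega)

theorem lowerFraction_swap (r : α → ℤ) (s : β → ℤ) (k i : ℤ)
    (hk : 0 < levelCount (fun z : α × β => r z.1 + s z.2) k) :
    lowerFraction r s k i = 1 - lowerFraction s r k (k - i - 1) := by
  classical
  unfold lowerFraction
  rw [levelCount_add_comm r s k, eq_sub_iff_add_eq, ← add_div, div_eq_one_iff_eq hk.ne',
    levelCount_add_eq_lower_add_upper r s k i]
  congr 2
  refine Finset.card_equiv (Equiv.prodComm β α) fun z => ?_
  simp only [Finset.mem_filter, Finset.mem_univ, true_and, Equiv.prodComm_apply, Prod.fst_swap,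
    Prod.snd_swap]
  omega

/-- This is `lowerFraction_anti` with the factors exchanged: both sides have the same threshold on
the second level. -/
theorem lowerFraction_le_shift {r : α → ℤ} {s : β → ℤ} (hr : IsLogConcaveSeq (levelCount r))
    {k l : ℤ} (hkl : k ≤ l) (hk : 0 < levelCount (fun z : α × β => r z.1 + s z.2) k)
    (hl : 0 < levelCount (fun z : α × β => r z.1 + s z.2) l) (i : ℤ) :
    lowerFraction r s k i ≤ lowerFraction r s l (i + (l - k)) := by
  rw [lowerFraction_swap r s k i hk, lowerFraction_swap r s l _ hl,
    show l - (i + (l - k)) - 1 = k - i - 1 by ring]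
  rw [← levelCount_add_comm r s] at hk hl
  exact sub_le_sub_left (lowerFraction_anti hr hkl hk hl _) 1

theorem lowerFraction_le_of_cross {r : α → ℤ} {s : β → ℤ}
    (hr : IsLogConcaveSeq (levelCount r)) (hs : IsLogConcaveSeq (levelCount s)) {z w : α × β}
    (h1 : r z.1 < r w.1) (h2 : s w.2 < s z.2) :
    lowerFraction r s (r z.1 + s z.2) (r z.1) ≤
      lowerFraction r s (r w.1 + s w.2) (r w.1 - 1) := by
  have hz := levelCount_pos (fun z : α × β => r z.1 + s z.2) z
  have hw := levelCount_pos (fun z : α × β => r z.1 + s z.2) w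
  -- If the total level does not rise, the first-level threshold is kept; otherwise the second-level
  -- one is.
  rcases le_total (r w.1 + s w.2) (r z.1 + s z.2) with h | h
  · exact (lowerFraction_anti hs h hw hz _).trans (lowerFraction_mono r s _ (by omega))
  · exact (lowerFraction_le_shift hr h hz hw _).trans (lowerFraction_mono r s _ (by omega))

/-- Think of intervals [B z, T z] lined up in [0, c]. Removing the rightmost leaves its left end as
the new bound. -/
theorem sum_sub_le_of_sorted {ι : Type*} [DecidableEq ι] (A : Finset ι) (key : ι → ℤ)
    (T B : ι → ℚ) (hB : ∀ z, 0 ≤ B z)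
    (h : ∀ z ∈ A, ∀ w ∈ A, z ≠ w → key z ≤ key w → T z ≤ B w) {c : ℚ} (hc : 0 ≤ c)
    (hT : ∀ z ∈ A, T z ≤ c) : ∑ z ∈ A, (T z - B z) ≤ c := by
  induction A using Finset.induction_on_max_value key generalizing c with
  | empty => simpa using hc
  | insert a s has hmax ih =>
    rw [Finset.sum_insert has]
    have h1 : ∑ z ∈ s, (T z - B z) ≤ B a := by
      refine ih (fun z hz w hw => h z (Finset.mem_insert_of_mem hz) w (Finset.mem_insert_of_mem hw))
        (hB a) fun z hz => ?_
      exact h z (Finset.mem_insert_of_mem hz) a (Finset.mem_insert_self _ _)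
        (fun e => has (e ▸ hz)) (hmax z hz)
    have h2 := hT a (Finset.mem_insert_self _ _)
    linarith

end LevelCount

/-! ### From antichains to functions bounded on chains. -/

section WeightedLYM

/-- If the `w`-weight of every antichain is at most `1`, then a nonnegative function whose sum
along every chain is at most `M` has `w`-weighted total at most `M`. -/
theorem sum_mul_le_of_chain_sum_le {P : Type*} [PartialOrder P] [Fintype P] {w : P → ℚ}
    (hw : ∀ A : Finset P, IsAntichain (· ≤ ·) (A : Set P) → ∑ x ∈ A, w x ≤ 1)
    (f : P → ℚ) (hf : ∀ x, 0 ≤ f x) (M : ℚ)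
    (hM : ∀ C : Finset P, IsChain (· ≤ ·) (C : Set P) → ∑ x ∈ C, f x ≤ M) :
    ∑ x, f x * w x ≤ M := by
  classical
  -- Peel off a multiple of the antichain of minimal support elements; its least value there is
  -- removed, so the support shrinks.
  induction hn : #{x | f x ≠ 0} using Nat.strong_induction_on generalizing f M with
  | _ n ih =>
    subst hn
    rcases Finset.eq_empty_or_nonempty (univ.filter fun x => f x ≠ 0) with hS | hS
    · have hz : ∀ x, f x = 0 := by simpa [Finset.filter_eq_empty_iff] using hS
      simpa [hz] using hM ∅ (by simp)
    set S := univ.filter fun x => f x ≠ 0 with hSdef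
    set A := S.filter fun x => Minimal (· ∈ S) x with hA
    have below : ∀ c ∈ S, ∃ a ∈ A, a ≤ c := by
      intro c hc
      obtain ⟨a, hac, ha⟩ := S.exists_le_minimal hc
      exact ⟨a, Finset.mem_filter.2 ⟨ha.prop, ha⟩, hac⟩
    have hAne : A.Nonempty := by
      obtain ⟨c, hc⟩ := hS
      obtain ⟨a, ha, -⟩ := below c hc
      exact ⟨a, ha⟩
    have hAanti : IsAntichain (· ≤ ·) (A : Set P) := by
      intro a ha b hb hab hle
      have ha' := Finset.mem_filter.1 (Finset.mem_coe.1 ha)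
      have hb' := Finset.mem_filter.1 (Finset.mem_coe.1 hb)
      exact hab (le_antisymm hle (hb'.2.le_of_le ha'.1 hle))
    obtain ⟨m, hm, hmin⟩ := A.exists_min_image f hAne
    have hmS : f m ≠ 0 := (Finset.mem_filter.1 (Finset.mem_filter.1 hm).1).2
    set g : P → ℚ := fun x => f x - if x ∈ A then f m else 0 with hg
    have hg0 : ∀ x, 0 ≤ g x := by
      intro x
      simp only [hg]
      split_ifs with hx
      · exact sub_nonneg.2 (hmin x hx)
      · simpa using hf x
    have gz : ∀ x, f x = 0 → g x = 0 := by
      intro x hx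
      have : x ∉ A := fun h => (Finset.mem_filter.1 (Finset.mem_filter.1 h).1).2 hx
      simp [hg, this, hx]
    have hchain : ∀ C : Finset P, IsChain (· ≤ ·) (C : Set P) → ∑ x ∈ C, g x ≤ M - f m := by
      intro C hC
      set C' := C.filter fun x => f x ≠ 0 with hC'
      have e : ∑ x ∈ C, g x = ∑ x ∈ C', g x := by
        rw [hC', Finset.sum_filter_of_ne]
        intro x _ hx h0
        exact hx (gz x h0)
      have hC'c : IsChain (· ≤ ·) (C' : Set P) :=
        hC.mono (Finset.coe_subset.2 (Finset.filter_subset _ _))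
      -- The support part of any chain extends down to meet A, so the bound on every chain sum drops
      -- by f m.
      obtain ⟨a, haA, hac⟩ : ∃ a ∈ A, ∀ c ∈ C', a ≤ c := by
        rcases C'.eq_empty_or_nonempty with h0 | hne
        · exact ⟨m, hm, by simp [h0]⟩
        · obtain ⟨c, hc⟩ := C'.exists_minimal hne
          have hcS : c ∈ S := by
            have := Finset.mem_filter.1 hc.prop
            simpa [hSdef] using this.2
          obtain ⟨a, ha, hle⟩ := below c hcS
          refine ⟨a, ha, fun d hd => hle.trans ?_⟩
          rcases hC'c.total (Finset.mem_coe.2 hc.prop) (Finset.mem_coe.2 hd) with h | h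
          · exact h
          · exact hc.le_of_le hd h
      have hins : IsChain (· ≤ ·) ((insert a C' : Finset P) : Set P) := by
        rw [Finset.coe_insert]
        exact hC'c.insert fun c hc _ => Or.inl (hac c hc)
      have h1 := hM _ hins
      have h2 : ∑ x ∈ C', g x ≤ ∑ x ∈ insert a C', g x :=
        Finset.sum_le_sum_of_subset_of_nonneg (Finset.subset_insert _ _) fun x _ _ => hg0 x
      have h3 : ∑ x ∈ insert a C', g x ≤ ∑ x ∈ insert a C', f x - f m := by
        simp only [hg]
        rw [Finset.sum_sub_distrib]
        refine sub_le_sub_left ?_ _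
        have := Finset.single_le_sum (s := insert a C')
          (f := fun x => if x ∈ A then f m else 0)
          (fun x _ => by split_ifs <;> simp [hf]) (Finset.mem_insert_self a C')
        simpa [haA] using this
      linarith
    have hcard : #{x | g x ≠ 0} < #S := by
      refine Finset.card_lt_card ((Finset.ssubset_iff_of_subset ?_).2 ⟨m, ?_, ?_⟩)
      · intro x hx
        simp only [hSdef, Finset.mem_filter, Finset.mem_univ, true_and] at hx ⊢
        exact fun h => hx (gz x h)
      · simpa [hSdef] using hmS
      · simp [hg, hm]
    have hrec := ih _ hcard g hg0 _ hchain rfl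
    have hsum : ∑ x, f x * w x = ∑ x, g x * w x + f m * ∑ x ∈ A, w x := by
      simp only [hg, sub_mul, Finset.sum_sub_distrib, ite_mul, zero_mul, Finset.mul_sum,
        Finset.sum_ite_mem, Finset.univ_inter, sub_add_cancel]
    have := mul_le_mul_of_nonneg_left (hw A hAanti) (hf m)
    linarith

end WeightedLYM

/-! ### Additivity of rank. -/

section Rank

variable {P Q : Type*} [PartialOrder P] [PartialOrder Q] [Finite P] [Finite Q]

theorem rank_lt_rank {x y : P} (h : x < y) : rank x < rank y :=
  (isGreatest_rank ⟨x, h⟩).2 ⟨x, h, rfl⟩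

theorem rank_le_rank {x y : P} (h : x ≤ y) : rank x ≤ rank y := by
  rcases h.eq_or_lt with rfl | h
  · exact le_rfl
  · exact (rank_lt_rank h).le

theorem exists_lt_rank_add_one {x : P} (h : rank x ≠ 0) : ∃ y < x, rank x = rank y + 1 := by
  have : ∃ y, y < x := by
    by_contra! hx
    exact h (rank_eq_zero hx)
  exact (isGreatest_rank this).1

theorem rank_prod (z : P × Q) : rank z = rank z.1 + rank z.2 := by
  induction z using WellFoundedLT.induction with
  | _ z ih =>
    apply le_antisymm
    · by_cases hz : rank z = 0
      · omega
      obtain ⟨w, hw, e⟩ := exists_lt_rank_add_one hz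
      rw [e, ih w hw]
      rcases Prod.lt_iff.1 hw with ⟨h1, h2⟩ | ⟨h1, h2⟩
      · have := rank_lt_rank h1
        have := rank_le_rank h2
        omega
      · have := rank_le_rank h1
        have := rank_lt_rank h2
        omega
    · obtain ⟨x, y⟩ := z
      by_cases hx : rank x = 0
      · by_cases hy : rank y = 0
        · simp [hx, hy]
        obtain ⟨v, hv, e⟩ := exists_lt_rank_add_one hy
        have hlt : (x, v) < (x, y) := Prod.mk_lt_mk_iff_right.2 hv
        have h1 := rank_lt_rank hlt
        rw [ih _ hlt] at h1
        simp only at h1 ⊢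
        omega
      · obtain ⟨u, hu, e⟩ := exists_lt_rank_add_one hx
        have hlt : (u, y) < (x, y) := Prod.mk_lt_mk_iff_left.2 hu
        have h1 := rank_lt_rank hlt
        rw [ih _ hlt] at h1
        simp only at h1 ⊢
        omega

end Rank

/-! ### Layer sizes and the product theorem. -/

section Product

variable {P Q : Type*} [PartialOrder P] [PartialOrder Q] [Fintype P] [Fintype Q]

/-- The layer sizes of a finite poset, indexed by the integers. -/
noncomputable def layerSize (P : Type*) [PartialOrder P] [Fintype P] : ℤ → ℚ :=
  levelCount fun x : P => (rank x : ℤ)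

theorem ncard_layer (k : ℕ) : ((layer P k).ncard : ℚ) = layerSize P k := by
  classical
  unfold layerSize levelCount layer
  rw [Set.ncard_eq_toFinset_card']
  congr 2
  ext x
  simp

theorem exists_rank_of_layerSize_ne_zero {k : ℤ} (h : layerSize P k ≠ 0) :
    ∃ x : P, (rank x : ℤ) = k := by
  by_contra! hx
  exact h (by simp [layerSize, levelCount, hx])

theorem layerSize_rank_pos (x : P) : 0 < layerSize P (rank x) :=
  levelCount_pos (fun x : P => (rank x : ℤ)) x

theorem isLogConcave_iff : IsLogConcave P ↔ IsLogConcaveSeq (layerSize P) := by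
  have h0 : ∀ k : ℕ, (layer P k).ncard ≠ 0 ↔ layerSize P k ≠ 0 := by
    intro k
    rw [← ncard_layer]
    exact_mod_cast Iff.rfl
  have pos : ∀ k, layerSize P k ≠ 0 → 0 < layerSize P k := fun k h =>
    lt_of_le_of_ne (levelCount_nonneg _ _) h.symm
  have nn : ∀ k, 0 ≤ layerSize P k := fun k => levelCount_nonneg _ _
  constructor
  · intro h a b hab
    by_cases ha : layerSize P (a - 1) = 0
    · rw [ha, zero_mul]
      exact mul_nonneg (nn _) (nn _)
    by_cases hb : layerSize P (b + 1) = 0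
    · rw [hb, mul_zero]
      exact mul_nonneg (nn _) (nn _)
    obtain ⟨x, hx⟩ := exists_rank_of_layerSize_ne_zero ha
    obtain ⟨y, hy⟩ := exists_rank_of_layerSize_ne_zero hb
    -- Nonempty layers have no gaps: layer b is nonempty because layer b + 1 is.
    obtain ⟨v, -, hv⟩ := exists_lt_rank_add_one (x := y) (by omega)
    obtain rfl : a = rank x + 1 := by omega
    obtain rfl : b = rank v := by omega
    have hxp := layerSize_rank_pos x
    have hvp := layerSize_rank_pos v
    have := h ((h0 _).2 hxp.ne') ((h0 _).2 hvp.ne') (by omega)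
    simp only [ncard_layer] at this
    rw [div_le_div_iff₀ hvp hxp] at this
    push_cast at this
    rw [add_sub_cancel_right]
    linarith
  · intro h k hk l hl hkl
    rw [Set.mem_ofPred_eq, h0] at hk hl
    simp only [ncard_layer]
    rcases hkl.eq_or_lt with rfl | hlt
    · exact le_rfl
    rw [div_le_div_iff₀ (pos _ hl) (pos _ hk)]
    have := h (k + 1) l (by omega)
    rw [add_sub_cancel_right] at this
    push_cast
    linarith

theorem layerSize_prod :
    layerSize (P × Q) = levelCount fun z : P × Q => (rank z.1 : ℤ) + (rank z.2 : ℤ) := by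
  unfold layerSize
  congr 1
  ext z
  rw [rank_prod]
  push_cast
  rfl

theorem rank_cross_of_antichain {C : Set P} {D : Set Q} (hC : IsChain (· ≤ ·) C)
    (hD : IsChain (· ≤ ·) D) {A : Set (P × Q)} (hA : IsAntichain (· ≤ ·) A) {z w : P × Q}
    (hz : z ∈ A) (hw : w ∈ A) (hzC : z.1 ∈ C) (hwC : w.1 ∈ C) (hzD : z.2 ∈ D) (hwD : w.2 ∈ D)
    (hne : z ≠ w) (hle : rank z.1 ≤ rank w.1) : rank z.1 < rank w.1 ∧ rank w.2 < rank z.2 := by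
  have h1 : z.1 ≤ w.1 := by
    rcases hC.total hzC hwC with h | h
    · exact h
    · rcases h.eq_or_lt with e | h
      · exact e.ge
      · exact absurd (rank_lt_rank h) (by omega)
  have h2 : ¬ z.2 ≤ w.2 := fun h => hA hz hw hne ⟨h1, h⟩
  have h3 : w.2 ≤ z.2 := (hD.total hzD hwD).resolve_left h2
  refine ⟨rank_lt_rank (h1.lt_of_ne fun e => ?_), rank_lt_rank (h3.lt_of_not_ge h2)⟩
  exact hA hw hz hne.symm ⟨e.ge, h3⟩

/-- The LYM inequality for the product of two chains, weighted by layer sizes. -/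
theorem sum_chain_prod_chain_le_one [DecidableEq P] [DecidableEq Q]
    (hP : IsLogConcaveSeq (layerSize P)) (hQ : IsLogConcaveSeq (layerSize Q))
    {A : Finset (P × Q)} (hA : IsAntichain (· ≤ ·) (A : Set (P × Q)))
    {C : Finset P} {D : Finset Q} (hC : IsChain (· ≤ ·) (C : Set P))
    (hD : IsChain (· ≤ ·) (D : Set Q)) :
    ∑ z ∈ A with z.1 ∈ C ∧ z.2 ∈ D, layerSize P (rank z.1) * layerSize Q (rank z.2) /
      layerSize (P × Q) (rank z) ≤ 1 := by
  set r : P → ℤ := fun x => rank x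
  set s : Q → ℤ := fun y => rank y
  have e : ∀ z : P × Q, layerSize P (rank z.1) * layerSize Q (rank z.2) /
      layerSize (P × Q) (rank z) =
      lowerFraction r s (r z.1 + s z.2) (r z.1) - lowerFraction r s (r z.1 + s z.2) (r z.1 - 1) := by
    intro z
    rw [lowerFraction_sub_lowerFraction, layerSize_prod, rank_prod]
    push_cast
    rfl
  simp only [e]
  refine sum_sub_le_of_sorted _ (fun z => r z.1) _ _ (fun z => lowerFraction_nonneg _ _ _ _) ?_
    zero_le_one fun z _ => lowerFraction_le_one _ _ _ _
  intro z hz w hw hne hle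
  rw [Finset.mem_filter] at hz hw
  have := rank_cross_of_antichain hC hD hA (Finset.mem_coe.2 hz.1) (Finset.mem_coe.2 hw.1)
    hz.2.1 hw.2.1 hz.2.2 hw.2.2 hne (Int.ofNat_le.1 hle)
  exact lowerFraction_le_of_cross hP hQ (Int.ofNat_lt.2 this.1) (Int.ofNat_lt.2 this.2)

theorem IsLYM.sum_le_one (h : IsLYM P) (A : Finset P) (hA : IsAntichain (· ≤ ·) (A : Set P)) :
    ∑ x ∈ A, 1 / layerSize P (rank x) ≤ 1 := by
  simpa only [ncard_layer] using h A hA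

theorem IsLYM.prod (hP : IsLYM P) (hQ : IsLYM Q) (hP' : IsLogConcaveSeq (layerSize P))
    (hQ' : IsLogConcaveSeq (layerSize Q)) : IsLYM (P × Q) := by
  classical
  intro A hA
  simp only [ncard_layer]
  set p : P → ℚ := fun x => layerSize P (rank x) with hp
  set q : Q → ℚ := fun y => layerSize Q (rank y) with hq
  set W : P × Q → ℚ := fun z => layerSize (P × Q) (rank z) with hW
  have p0 : ∀ x, 0 < p x := layerSize_rank_pos
  have q0 : ∀ y, 0 < q y := layerSize_rank_pos
  have W0 : ∀ z, 0 < W z := layerSize_rank_pos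
  -- The factors p x and q y cancel the weights 1 / p x and 1 / q y brought in by the two
  -- applications of LYM.
  set F : P → Q → ℚ := fun x y => if (x, y) ∈ A then p x * q y / W (x, y) else 0 with hF
  have F0 : ∀ x y, 0 ≤ F x y := by
    intro x y
    simp only [hF]
    split_ifs
    · exact (div_pos (mul_pos (p0 x) (q0 y)) (W0 _)).le
    · exact le_rfl
  have hCD : ∀ C : Finset P, IsChain (· ≤ ·) (C : Set P) →
      ∀ D : Finset Q, IsChain (· ≤ ·) (D : Set Q) → ∑ y ∈ D, ∑ x ∈ C, F x y ≤ 1 := by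
    intro C hC D hD
    refine le_of_eq_of_le ?_ (sum_chain_prod_chain_le_one hP' hQ' hA hC hD)
    rw [Finset.sum_comm, ← Finset.sum_product', ← Finset.sum_filter]
    refine Finset.sum_congr ?_ fun z _ => rfl
    ext z
    simp [and_comm]
  have hC : ∀ C : Finset P, IsChain (· ≤ ·) (C : Set P) →
      ∑ x ∈ C, ∑ y, F x y * (1 / q y) ≤ 1 := by
    intro C hC
    have := sum_mul_le_of_chain_sum_le hQ.sum_le_one (fun y => ∑ x ∈ C, F x y)
      (fun y => Finset.sum_nonneg fun x _ => F0 x y) 1 (hCD C hC)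
    simp only [Finset.sum_mul] at this
    rwa [Finset.sum_comm] at this
  have h := sum_mul_le_of_chain_sum_le hP.sum_le_one (fun x => ∑ y, F x y * (1 / q y))
    (fun x => Finset.sum_nonneg fun y _ => mul_nonneg (F0 x y) (one_div_pos.2 (q0 y)).le) 1 hC
  refine le_of_eq_of_le ?_ h
  simp only [Finset.sum_mul]
  rw [← Fintype.sum_prod_type', ← Finset.sum_filter_add_sum_filter_not univ (· ∈ A)]
  rw [Finset.sum_eq_zero (s := univ.filter (· ∉ A)), add_zero]
  · refine Finset.sum_congr (by ext; simp) fun z hz => ?_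
    have := (p0 z.1).ne'
    have := (q0 z.2).ne'
    have := (W0 z).ne'
    simp only [hF, Prod.mk.eta, (Finset.mem_filter.1 hz).2, if_true]
    change 1 / W z = p z.1 * q z.2 / W z * (1 / q z.2) * (1 / p z.1)
    field_simp
  · intro z hz
    simp [hF, (Finset.mem_filter.1 hz).2]

theorem isLogConcave_prod (hP : IsLogConcaveSeq (layerSize P))
    (hQ : IsLogConcaveSeq (layerSize Q)) : IsLogConcave (P × Q) := by
  rw [isLogConcave_iff, layerSize_prod]
  exact IsLogConcaveSeq.levelCount_add (r := fun x : P => (rank x : ℤ))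
    (s := fun y : Q => (rank y : ℤ)) hP hQ

end Product

end RankedPoset

theorem theorem2p1 {P : Type*} {Q : Type*} [PartialOrder P] [Finite P]
    [PartialOrder Q] [Finite Q]
    (hP : RankedPoset.IsLYM P) (hP' : RankedPoset.IsLogConcave P)
    (hQ : RankedPoset.IsLYM Q) (hQ' : RankedPoset.IsLogConcave Q) :
    RankedPoset.IsLYM (P × Q) ∧ RankedPoset.IsLogConcave (P × Q) := by
  have := Fintype.ofFinite P
  have := Fintype.ofFinite Q
  have hP₁ := RankedPoset.isLogConcave_iff.1 hP'
  have hQ₁ := RankedPoset.isLogConcave_iff.1 hQ'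
  exact ⟨hP.prod hQ hP₁ hQ₁, RankedPoset.isLogConcave_prod hP₁ hQ₁⟩
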